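/- Let $q$ be a prime power and $\mathbb F_q$ the field with $q$ elements. For a matrix $X\in M(n,q)$ (the $n\times n$ matrices over $\mathbb F_q$) and a monic irreducible polynomial $g\in\mathbb F_q[t]$, let $V(g)$ be the $g$-primary component of the row space $V=\mathbb F_q^{1\times n}$, regarded as an $\mathbb F_q[t]$-module with $t$ acting by $v\mapsto vX$. Call $X$ *uncyclic* if $V(g)$ is not a cyclic $\mathbb F_q[t]$-module for every monic irreducible divisor $g$ of the characteristic polynomial of $X$, and let $\mathrm{unc}(n,q)$ be the number of uncyclic matrices in $M(n,q)$. For a partition $\lambda=(\lambda_1\ge\lambda_2\ge\cdots)$ let $|\lambda|$ be the sum of its parts, $\lambda'$ its conjugate partition, $m_i(\lambda)$ the number of parts equal to $i$, $\ell_i(\lambda)=\lambda'_1+\cdots+\lambda'_i$, and $$c(\lambda,q)=\prod_{i=1}^{\lambda_1}\prod_{k=1}^{m_i(\lambda)}\bigl(q^{\ell_i(\lambda)}-q^{\ell_i(\lambda)-k}\bigr)$$ (so $c((),q)=1$). Put $$\mathrm{Unc}_q(u)=1+\sum_{n\ge1}\frac{\mathrm{unc}(n,q)}{|\mathrm{GL}(n,q)|}\,u^n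 .$$ Let $\Lambda_1$ be the set of partitions $\lambda$ with $\lambda'_1\ne1$; equivalently, those having $0$ or at least $2$ parts. Then, as an identity of formal power series in $\mathbb Q[[u]]$, $$\mathrm{Unc}_q(u)=\sum_{n\ge0}\frac{\mathrm{unc}(n,q)}{|\mathrm{GL}(n,q)|}\,u^n=\prod_f\left(\sum_{\lambda\in\Lambda_1}\frac{u^{|\lambda|\deg f}}{c(\lambda,q^{\deg f})}\right),$$ where $f$ runs over all monic irreducible polynomials in $\mathbb F_q[t]$, and where the inner sums and the product converge formally (each coefficient is eventually constant). -/

import Mathlib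

open scoped Polynomial PowerSeries PowerSeries.WithPiTopology

noncomputable section

namespace Uncyclic

/-- Partitions of arbitrary non-negative integers (multisets of positive parts). -/
abbrev AnyPartition : Type := Σ n : ℕ, n.Partition

namespace AnyPartition

/-- `|l|`, the sum of the parts. -/
def size (l : AnyPartition) : ℕ := l.1

/-- The multiset of (positive) parts. -/
def parts (l : AnyPartition) : Multiset ℕ := l.2.parts

/-- `l_1`, the largest part (`0` for the empty partition). -/
def largest (l : AnyPartition) : ℕ := l.parts.sup

/-- `m_i(l)`, the number of parts equal to `i`. -/
def mult (l : AnyPartition) (i : ℕ) : ℕ := l.parts.count i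

/-- `l'_i`, the `i`-th part of the conjugate partition for `i ≥ 1`:
the length of column `i` of the Young diagram, i.e. the number of parts that are at least `i`. -/
def conj (l : AnyPartition) (i : ℕ) : ℕ := l.parts.countP (fun p => i ≤ p)

/-- `ℓ_i(l)`, the number of boxes in the first `i` columns of the Young diagram. -/
def firstCols (l : AnyPartition) (i : ℕ) : ℕ := ∑ j ∈ Finset.Icc 1 i, l.conj j

/-- `c(l, q) = ∏_{i=1}^{l_1} ∏_{k=1}^{m_i(l)} (q^{ℓ_i(l)} - q^{ℓ_i(l) - k})`.
The exponent `ℓ_i(l) - k` never truncates, as `k ≤ m_i(l) ≤ ℓ_i(l)`. -/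
def c (l : AnyPartition) (q : ℚ) : ℚ :=
  ∏ i ∈ Finset.Icc 1 l.largest, ∏ k ∈ Finset.Icc 1 (l.mult i),
    (q ^ l.firstCols i - q ^ (l.firstCols i - k))

end AnyPartition

/-- `Λ₁`, the set of partitions `l` with `l'_1 ≠ 1`. -/
def Lambda1 : Set AnyPartition := {l | l.conj 1 ≠ 1}

section Matrices

variable {F : Type*} [Field F]

/-- The row space `F^{1 × n}` as an `F[t]`-module on which `t` acts by `v ↦ v X`. -/
abbrev RowModule {n : ℕ} (X : Matrix (Fin n) (Fin n) F) : Type _ :=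
  Module.AEval' (Matrix.vecMulLinear X)

/-- The `g`-primary component `V(g)` of the row space, an `F[t]`-submodule. -/
def primaryPart {n : ℕ} (X : Matrix (Fin n) (Fin n) F) (g : F[X]) :
    Submodule F[X] (RowModule X) :=
  Ideal.primaryComponent (RowModule X) (Ideal.span {g})

/-- `X` is `f`-cyclic relative to `g`: the `g`-primary component is a cyclic `F[t]`-module,
that is, it is generated by a single vector. -/
def IsCyclicAt {n : ℕ} (X : Matrix (Fin n) (Fin n) F) (g : F[X]) : Prop :=
  ∃ v : RowModule X, primaryPart X g = Submodule.span F[X] {v}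

/-- `X` is uncyclic: it is not `f`-cyclic relative to any monic irreducible divisor of its
characteristic polynomial. -/
def IsUncyclic {n : ℕ} (X : Matrix (Fin n) (Fin n) F) : Prop :=
  ∀ g : F[X], g.Monic → Irreducible g → g ∣ X.charpoly → ¬ IsCyclicAt X g

variable (F)

/-- The monic irreducible polynomials over `F`. -/
abbrev MonicIrred : Type _ := {f : F[X] // f.Monic ∧ Irreducible f}

/-- `unc(n, q)`, the number of uncyclic `n × n` matrices over the field `F` of order `q`. -/
def unc (n : ℕ) : ℕ := Nat.card {X : Matrix (Fin n) (Fin n) F // IsUncyclic X}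

/-- `Unc_q(u) = 1 + ∑_{n ≥ 1} unc(n, q) / |GL(n, q)| u^n`, as a formal power series. -/
def uncSeries : ℚ⟦X⟧ :=
  PowerSeries.mk fun n =>
    if n = 0 then 1 else (unc F n : ℚ) / (Nat.card (Matrix.GeneralLinearGroup (Fin n) F) : ℚ)

variable {F}

/-- The term `u^{|l| d(f)} / c(l, q^{d(f)})`, with `q = |F|` and `d(f) = deg f`. -/
def factorTerm (f : MonicIrred F) (l : AnyPartition) : ℚ⟦X⟧ :=
  PowerSeries.monomial (l.size * f.1.natDegree)
    (1 / l.c ((Nat.card F : ℚ) ^ f.1.natDegree))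

end Matrices

end Uncyclic

end

/-! Similarity classes in M(n,q) are isomorphism classes of n-dimensional F[t]-modules, that is,
families of partitions λ_f over the monic irreducibles f with ∑ |λ_f| deg f = n. By orbit-stabiliser
a class has |GL(n,q)| / |Aut| members (`card_rowModule_equiv_mul_card_aut`), and |Aut| = ∏ c(λ_f,
q^deg f) (`card_aut_typeModule`). The parts of λ_f count the cyclic summands of V(f), so a matrix is
uncyclic exactly when every λ_f lies in Λ₁ (`isUncyclic_iff`). Hence the n-th coefficient is a sum
of products of 1/c, which is what expanding the product over f gives; only the finitely many f of
degree at most n matter.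

For |Aut|: an automorphism of a finite module is an injective endomorphism, and injectivity is
tested on elements killed by some f. It therefore amounts to choosing images v_j of the generators
of order f^(e_j) such that the f^(e_j - 1) v_j are independent over F[t]/(f), for each f separately.
Choosing them from the largest e_j down, the number of choices at each step depends only on e_j and
on how many were chosen before (`card_extend`); the product of these numbers is c (`c_eq_listProd`).
-/

noncomputable section

namespace Uncyclic

/-! ### Partitions: rows, columns and the formula for c -/

namespace AnyPartition

theorem sum_Icc_countP_le (s : Multiset ℕ) (i : ℕ) :
    ∑ j ∈ Finset.Icc 1 i, s.countP (fun p => j ≤ p) = (s.map (min i)).sum := by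
  induction s using Multiset.induction_on with
  | empty => simp
  | cons a s ih =>
    simp only [Multiset.countP_cons, Finset.sum_add_distrib, ih, Multiset.map_cons,
      Multiset.sum_cons]
    rw [add_comm, Finset.sum_boole]
    congr 1
    have : (Finset.Icc 1 i).filter (fun j => j ≤ a) = Finset.Icc 1 (min i a) := by
      ext j; simp; omega
    rw [this]; simp

/-- A row of length p has min(i, p) boxes in the first i columns. This form matches the f^i-torsion
of a direct sum of modules F[t]/(f^p). -/
theorem firstCols_eq_sum_min (l : AnyPartition) (i : ℕ) :
    l.firstCols i = (l.parts.map (min i)).sum :=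
  sum_Icc_countP_le _ _

theorem firstCols_succ (l : AnyPartition) (i : ℕ) :
    l.firstCols (i + 1) = l.firstCols i + l.conj (i + 1) := by
  simp [firstCols, Finset.sum_Icc_succ_top]

theorem firstCols_one (l : AnyPartition) : l.firstCols 1 = l.conj 1 := by
  simp [firstCols]

theorem parts_pos (l : AnyPartition) {i : ℕ} (hi : i ∈ l.parts) : 0 < i :=
  l.2.parts_pos hi

theorem parts_sum (l : AnyPartition) : l.parts.sum = l.size := l.2.parts_sum

theorem conj_one (l : AnyPartition) : l.conj 1 = l.parts.card := by
  rw [conj, Multiset.countP_eq_card]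
  exact fun a ha => l.parts_pos ha

theorem conj_eq (l : AnyPartition) (i : ℕ) :
    l.conj i = l.parts.countP (fun p => i < p) + l.mult i := by
  unfold conj mult
  generalize l.parts = s
  induction s using Multiset.induction_on with
  | empty => simp
  | cons a s ih =>
    simp only [Multiset.countP_cons, Multiset.count_cons, ih]
    split_ifs <;> omega

theorem conj_eq_conj_succ_add_mult (l : AnyPartition) (i : ℕ) :
    l.conj i = l.conj (i + 1) + l.mult i :=
  conj_eq l i

theorem ext_parts {l m : AnyPartition} (h : l.parts = m.parts) : l = m := by
  have hs : l.size = m.size := by rw [← parts_sum, ← parts_sum, h]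
  obtain ⟨n, l⟩ := l
  obtain ⟨k, m⟩ := m
  obtain rfl : n = k := hs
  congr 1
  exact Nat.Partition.ext h

/-- First differences give the columns, second differences the multiplicities. Used to recover a
module's type from its torsion cardinalities. -/
theorem ext_firstCols {l m : AnyPartition} (h : ∀ i, l.firstCols i = m.firstCols i) : l = m := by
  have hc : ∀ i, l.conj (i + 1) = m.conj (i + 1) := fun i => by
    have h1 := l.firstCols_succ i
    have h2 := m.firstCols_succ i
    have h3 := h i
    have h4 := h (i + 1)
    omega
  apply ext_parts
  ext i
  rcases i with _ | i
  · rw [Multiset.count_eq_zero_of_notMem, Multiset.count_eq_zero_of_notMem]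
    · exact fun h => (m.parts_pos h).ne rfl
    · exact fun h => (l.parts_pos h).ne rfl
  · have h1 := l.conj_eq_conj_succ_add_mult (i + 1)
    have h2 := m.conj_eq_conj_succ_add_mult (i + 1)
    have h3 := hc i
    have h4 := hc (i + 1)
    change l.mult (i + 1) = m.mult (i + 1)
    omega

/-- The partition whose parts are the elements of a multiset of positive integers. -/
def ofParts (s : Multiset ℕ) : AnyPartition := ⟨s.sum, Nat.Partition.ofMultiset s⟩

theorem parts_ofParts {s : Multiset ℕ} (hs : ∀ i ∈ s, 0 < i) : (ofParts s).parts = s :=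
  Multiset.filter_eq_self.2 fun a ha => (hs a ha).ne'

/-- The parts of a partition in increasing order. -/
def sorted (l : AnyPartition) : List ℕ := l.parts.sort (· ≤ ·)

theorem coe_sorted (l : AnyPartition) : (l.sorted : Multiset ℕ) = l.parts :=
  Multiset.sort_eq _ _

theorem pairwise_sorted (l : AnyPartition) : l.sorted.Pairwise (· ≤ ·) :=
  Multiset.pairwise_sort _ _

theorem mem_sorted {l : AnyPartition} {i : ℕ} : i ∈ l.sorted ↔ i ∈ l.parts := by
  rw [← coe_sorted, Multiset.mem_coe]

theorem pos_of_mem_sorted {l : AnyPartition} {i : ℕ} (hi : i ∈ l.sorted) : 0 < i :=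
  l.parts_pos (mem_sorted.1 hi)

theorem length_sorted (l : AnyPartition) : l.sorted.length = l.conj 1 := by
  rw [conj_one, ← coe_sorted, Multiset.coe_card]

theorem sum_get_sorted {M : Type*} [AddCommMonoid M] (l : AnyPartition) (g : ℕ → M) :
    ∑ j, g (l.sorted.get j) = (l.parts.map g).sum := by
  rw [← coe_sorted, Multiset.map_coe, Multiset.sum_coe, ← List.sum_ofFn]
  congr 1
  apply List.ext_get <;> simp

end AnyPartition

theorem mem_Lambda1_iff (l : AnyPartition) :
    l ∈ Lambda1 ↔ l.parts.card = 0 ∨ 2 ≤ l.parts.card := by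
  change l.conj 1 ≠ 1 ↔ _
  rw [AnyPartition.conj_one]
  omega

/-- The product `∏ (t(e) - t(e - 1) q^r)` over the entries `e` of a list, where `r` is the number
of entries to the right of `e`. -/
def listProd (t : ℕ → ℚ) (q : ℚ) : List ℕ → ℚ
  | [] => 1
  | e :: L => (t e - t (e - 1) * q ^ L.length) * listProd t q L

/-- Equal entries are grouped: in a sorted list, what stands to the right of a copy of i is every
larger entry and the k remaining copies of i. -/
theorem listProd_eq_prod (t : ℕ → ℚ) (q : ℚ) (N : ℕ) (L : List ℕ) (hL : L.Pairwise (· ≤ ·))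
    (hN : ∀ i ∈ L, i ∈ Finset.Icc 1 N) :
    listProd t q L = ∏ i ∈ Finset.Icc 1 N, ∏ k ∈ Finset.range (L.count i),
      (t i - t (i - 1) * q ^ (L.countP (fun p => i < p) + k)) := by
  induction L with
  | nil => simp [listProd]
  | cons e L ih =>
    rw [List.pairwise_cons] at hL
    have he := hN e (by simp)
    rw [listProd, ih hL.2 fun i hi => hN i (by simp [hi]),
      ← Finset.mul_prod_erase _ _ he, ← Finset.mul_prod_erase _ _ he, ← mul_assoc]
    congr 1
    · rw [List.count_cons_self, Finset.prod_range_succ, mul_comm]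
      have hlen : L.length = L.countP (fun p => e < p) + L.count e := by
        have h := hL.1
        clear ih hL hN
        induction L with
        | nil => rfl
        | cons a L ih =>
          have h1 := ih fun b hb => h b (by simp [hb])
          have h2 := h a (by simp)
          rw [List.length_cons, List.countP_cons, List.count_cons, h1]
          by_cases hae : a = e
          · simp [hae]; omega
          · have : e < a := by omega
            simp [hae, this]; omega
      rw [hlen]
      simp
    · refine Finset.prod_congr rfl fun i hi => ?_
      have hie : e ≠ i := (Finset.ne_of_mem_erase hi).symm
      rw [List.count_cons_of_ne hie, List.countP_cons]
      -- Prepending e changes the count of larger entries only for i < e, and such i do not occur in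
      -- L, so their inner product is empty.
      by_cases h : i < e
      · have : L.count i = 0 := List.count_eq_zero.2 fun hi => by
          have := hL.1 i hi
          omega
        simp [this]
      · simp [h]

/-- With m the multiplicity of i, ℓ_i = ℓ_(i-1) + λ'_(i+1) + m. So the exponents ℓ_(i-1) + λ'_(i+1)
+ k for k < m are the ℓ_i - k for 1 ≤ k ≤ m, in reverse order. -/
theorem c_eq_listProd (l : AnyPartition) (q : ℚ) :
    l.c q = listProd (fun i => q ^ l.firstCols i) q l.sorted := by
  rw [listProd_eq_prod _ _ l.largest _ l.pairwise_sorted, AnyPartition.c]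
  · refine Finset.prod_congr rfl fun i hi => ?_
    obtain ⟨i, rfl⟩ : ∃ j, i = j + 1 := ⟨i - 1, by simp at hi; omega⟩
    have hcount : l.sorted.count (i + 1) = l.mult (i + 1) := by
      rw [AnyPartition.mult, ← l.coe_sorted, Multiset.coe_count]
    have hcountP : l.sorted.countP (fun p => i + 1 < p) = l.conj (i + 1 + 1) := by
      rw [AnyPartition.conj, ← l.coe_sorted, Multiset.coe_countP]
      rfl
    have h1 := l.firstCols_succ i
    have h2 := l.conj_eq_conj_succ_add_mult (i + 1)
    rw [hcount, hcountP, ← Finset.prod_range_reflect]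
    refine Finset.prod_nbij' (· - 1) (· + 1) ?_ ?_ ?_ ?_ ?_
    · intro k hk
      simp only [Finset.mem_Icc, Finset.mem_range] at hk ⊢
      omega
    · intro k hk
      simp only [Finset.mem_Icc, Finset.mem_range] at hk ⊢
      omega
    · intro k hk
      simp only [Finset.mem_Icc] at hk
      omega
    · intro k _
      omega
    · intro k hk
      simp only [Finset.mem_Icc] at hk
      rw [← pow_add, Nat.add_sub_cancel]
      congr 2
      omega
  · intro i hi
    rw [Finset.mem_Icc]
    exact ⟨AnyPartition.pos_of_mem_sorted hi, Multiset.le_sup (AnyPartition.mem_sorted.1 hi)⟩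

/-! ### Cardinalities of kernels and preimages -/

section Card

variable {R M N : Type*} [CommRing R] [AddCommGroup M] [Module R M] [AddCommGroup N] [Module R N]

theorem card_eq_card_ker_mul_card_range (φ : M →ₗ[R] N) :
    Nat.card M = Nat.card (LinearMap.ker φ) * Nat.card (LinearMap.range φ) := by
  rw [AddSubgroup.card_eq_card_quotient_mul_card_addSubgroup (LinearMap.ker φ).toAddSubgroup,
    mul_comm, ← Nat.card_congr φ.quotKerEquivRange.toEquiv]
  rfl

theorem card_comap_of_le_range (φ : M →ₗ[R] N) (W : Submodule R N) (hW : W ≤ LinearMap.range φ) :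
    Nat.card (W.comap φ) = Nat.card (LinearMap.ker φ) * Nat.card W := by
  let ψ : W.comap φ →ₗ[R] W := φ.restrict fun _ hx => hx
  have hr : LinearMap.range ψ = ⊤ := by
    rw [LinearMap.range_eq_top]
    rintro ⟨y, hy⟩
    obtain ⟨x, rfl⟩ := hW hy
    exact ⟨⟨x, hy⟩, rfl⟩
  rw [card_eq_card_ker_mul_card_range ψ, hr, Nat.card_congr Submodule.topEquiv.toEquiv]
  congr 1
  refine Nat.card_congr
    { toFun := fun x => ⟨x.1.1, congrArg Subtype.val (LinearMap.mem_ker.1 x.2)⟩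
      invFun := fun x => ⟨⟨x.1, by
        have := x.2
        rw [LinearMap.mem_ker] at this
        simp [this]⟩, Subtype.ext x.2⟩
      left_inv := fun x => rfl
      right_inv := fun x => rfl }

end Card

/-! ### Counting independent tuples -/

section IndepMod

variable {R N : Type*} [CommRing R] [AddCommGroup N] [Module R N]

/-- The family `w` satisfies no relation except those with all coefficients divisible by `f`. -/
def IndepMod {ι : Type*} [Fintype ι] (f : R) (w : ι → N) : Prop :=
  ∀ a : ι → R, ∑ j, a j • w j = 0 → ∀ j, f ∣ a j

/-- Linear algebra over the field R/(f): a coefficient of x not divisible by f is invertible modulo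
f, and since f kills x the relation can be solved for x. -/
theorem indepMod_fin_cons {f : R} (hf : (Ideal.span {f}).IsMaximal) {n : ℕ} {x : N} {w : Fin n → N}
    (hx : f • x = 0) :
    IndepMod f (Fin.cons x w : Fin (n + 1) → N) ↔
      IndepMod f w ∧ x ∉ Submodule.span R (Set.range w) := by
  constructor
  · intro h
    refine ⟨fun a ha j => ?_, fun hmem => ?_⟩
    · simpa using h (Fin.cons 0 a) (by simpa [Fin.sum_univ_succ] using ha) j.succ
    · obtain ⟨a, ha⟩ := (Submodule.mem_span_range_iff_exists_fun R).1 hmem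
      have := h (Fin.cons (-1) a) (by simp [Fin.sum_univ_succ, ha]) 0
      apply hf.ne_top
      rw [Ideal.span_singleton_eq_top]
      exact isUnit_of_dvd_unit this (by simp)
  · rintro ⟨h, hmem⟩ a ha
    rw [Fin.sum_univ_succ] at ha
    simp only [Fin.cons_zero, Fin.cons_succ] at ha
    have h0 : f ∣ a 0 := by
      by_contra hd
      apply hmem
      have hd' : a 0 ∉ Ideal.span {f} := by rwa [Ideal.mem_span_singleton]
      obtain ⟨b, c, hc, hbc⟩ := hf.exists_inv hd'
      obtain ⟨d, rfl⟩ := Ideal.mem_span_singleton'.1 hc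
      rw [Submodule.mem_span_range_iff_exists_fun]
      refine ⟨fun j => -(b * a j.succ), ?_⟩
      have hx1 : x = b • a 0 • x := by
        conv_lhs => rw [← one_smul R x, ← hbc, add_smul, mul_smul, mul_smul, hx, smul_zero, add_zero]
      rw [hx1, eq_neg_of_add_eq_zero_left ha, smul_neg, Finset.smul_sum, ← Finset.sum_neg_distrib]
      simp [mul_smul]
    intro j
    refine Fin.cases h0 (fun j => ?_) j
    refine h (fun j => a j.succ) ?_ j
    obtain ⟨d, hd⟩ := h0
    rw [hd, mul_comm, mul_smul, hx, smul_zero, zero_add] at ha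
    exact ha

theorem card_span_range_of_indepMod {f : R} {n : ℕ} {w : Fin n → N}
    (hw : ∀ j, f • w j = 0) (h : IndepMod f w) :
    Nat.card (Submodule.span R (Set.range w)) = Nat.card (R ⧸ Ideal.span {f}) ^ n := by
  have hr : Submodule.span R (Set.range w) = LinearMap.range (Fintype.linearCombination R w) :=
    (Fintype.range_linearCombination R w).symm
  have hk : LinearMap.ker (Fintype.linearCombination R w) =
      Submodule.pi Set.univ fun _ => Ideal.span {f} := by
    ext a
    simp only [LinearMap.mem_ker, Fintype.linearCombination_apply, Submodule.mem_pi, Set.mem_univ,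
      true_imp_iff, Ideal.mem_span_singleton]
    refine ⟨h a, fun ha => Finset.sum_eq_zero fun j _ => ?_⟩
    obtain ⟨d, hd⟩ := ha j
    rw [hd, mul_comm, mul_smul, hw, smul_zero]
  rw [hr, ← Nat.card_congr (LinearMap.quotKerEquivRange _).toEquiv, hk,
    Nat.card_congr (Submodule.quotientPi fun _ : Fin n => Ideal.span {f}).toEquiv, Nat.card_pi]
  simp

/-- The bad x form the preimage of the span W under multiplication by f^(e-1). As e ≤ L j, W lies in
the image, so this preimage has size |ker| · |W|, and |W| = |R/(f)|^n by independence. -/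
theorem card_extend [Finite N] {f : R} {n : ℕ} {L : Fin n → ℕ} {e : ℕ} (he : 0 < e)
    (hL : ∀ j, e ≤ L j) {w : Fin n → N} (hw : ∀ j, f ^ L j • w j = 0)
    (h : IndepMod f fun j => f ^ (L j - 1) • w j) :
    (Nat.card {x : N // f ^ e • x = 0 ∧
      f ^ (e - 1) • x ∉ Submodule.span R (Set.range fun j => f ^ (L j - 1) • w j)} : ℚ) =
    Nat.card (Submodule.torsionBy R N (f ^ e)) - Nat.card (Submodule.torsionBy R N (f ^ (e - 1))) *
      (Nat.card (R ⧸ Ideal.span {f}) : ℚ) ^ n := by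
  set W := Submodule.span R (Set.range fun j => f ^ (L j - 1) • w j) with hWdef
  have hwf : ∀ j, f • f ^ (L j - 1) • w j = 0 := fun j => by
    rw [smul_smul, ← pow_succ', Nat.sub_add_cancel (he.trans_le (hL j)), hw]
  have hWf : ∀ y ∈ W, f • y = 0 := by
    intro y hy
    have : W ≤ Submodule.torsionBy R N f := by
      rw [hWdef, Submodule.span_le]
      rintro _ ⟨j, rfl⟩
      exact hwf j
    exact this hy
  let φ : N →ₗ[R] N := LinearMap.lsmul R N (f ^ (e - 1))
  have hφ : W ≤ LinearMap.range φ := by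
    rw [hWdef, Submodule.span_le]
    rintro _ ⟨j, rfl⟩
    refine ⟨f ^ (L j - e) • w j, ?_⟩
    have := hL j
    simp only [φ, LinearMap.lsmul_apply, smul_smul, ← pow_add]
    congr 2
    omega
  have hcard := card_comap_of_le_range φ W hφ
  have hker : LinearMap.ker φ = Submodule.torsionBy R N (f ^ (e - 1)) := rfl
  rw [hker, card_span_range_of_indepMod hwf h] at hcard
  -- Since f kills W, every bad x is already killed by f^e, so the count is an exact difference.
  have hle : W.comap φ ≤ Submodule.torsionBy R N (f ^ e) := by
    intro x hx
    have := hWf _ hx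
    rw [LinearMap.lsmul_apply, smul_smul, ← pow_succ', Nat.sub_add_cancel he] at this
    exact this
  have hsplit : Nat.card (Submodule.torsionBy R N (f ^ e)) =
      Nat.card (W.comap φ) + Nat.card {x : N // f ^ e • x = 0 ∧ f ^ (e - 1) • x ∉ W} := by
    rw [← Nat.card_sum]
    classical
    refine Nat.card_congr ((Equiv.sumCompl fun x : Submodule.torsionBy R N (f ^ e) =>
      (x : N) ∈ W.comap φ).symm.trans (Equiv.sumCongr ?_ ?_))
    · exact
        { toFun := fun x => ⟨x.1.1, x.2⟩
          invFun := fun x => ⟨⟨x.1, hle x.2⟩, x.2⟩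
          left_inv := fun _ => rfl
          right_inv := fun _ => rfl }
    · exact
        { toFun := fun x => ⟨x.1.1, x.1.2, x.2⟩
          invFun := fun x => ⟨⟨x.1, x.2.1⟩, x.2.2⟩
          left_inv := fun _ => rfl
          right_inv := fun _ => rfl }
  rw [hsplit, hcard]
  push_cast
  ring

/-- The tuples `v` with `v j` killed by `f ^ L[j]` such that the elements `f ^ (L[j] - 1) • v j`
are independent modulo `f`. -/
def IndepTuple (N : Type*) [AddCommGroup N] [Module R N] (f : R) (L : List ℕ) : Type _ :=
  {v : Fin L.length → N // (∀ j, f ^ L.get j • v j = 0) ∧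
    IndepMod f fun j => f ^ (L.get j - 1) • v j}

theorem indepMod_smul_cons_iff {f : R} (hf : (Ideal.span {f}).IsMaximal) {e : ℕ} (he : 0 < e)
    (L : List ℕ) {x : N} (w : Fin L.length → N) (hx : f ^ e • x = 0) :
    IndepMod f (fun j : Fin (e :: L).length =>
      f ^ ((e :: L).get j - 1) • (Fin.cons x w : Fin (L.length + 1) → N) j) ↔
    (IndepMod f fun j => f ^ (L.get j - 1) • w j) ∧
      f ^ (e - 1) • x ∉ Submodule.span R (Set.range fun j => f ^ (L.get j - 1) • w j) := by
  rw [← indepMod_fin_cons hf (by rwa [smul_smul, ← pow_succ', Nat.sub_add_cancel he])]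
  have : (fun j : Fin (e :: L).length =>
      f ^ ((e :: L).get j - 1) • (Fin.cons x w : Fin (L.length + 1) → N) j) =
      (Fin.cons (f ^ (e - 1) • x) fun j => f ^ (L.get j - 1) • w j : Fin (L.length + 1) → N) := by
    funext j
    refine Fin.cases ?_ (fun j => ?_) j <;> rfl
  rw [this]

/-- Splitting the first entry off an independent tuple. -/
def indepTupleConsEquiv {f : R} (hf : (Ideal.span {f}).IsMaximal) {e : ℕ} (he : 0 < e)
    (L : List ℕ) :
    IndepTuple N f (e :: L) ≃ Σ w : IndepTuple N f L, {x : N // f ^ e • x = 0 ∧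
      f ^ (e - 1) • x ∉ Submodule.span R (Set.range fun j => f ^ (L.get j - 1) • w.1 j)} where
  toFun v :=
    have h := (indepMod_smul_cons_iff hf he L (fun j => v.1 j.succ) (v.2.1 0)).1 (by
      have := v.2.2
      rwa [← Fin.cons_self_tail (α := fun _ => N) v.1] at this)
    ⟨⟨fun j => v.1 j.succ, fun j => v.2.1 j.succ, h.1⟩, ⟨v.1 0, v.2.1 0, h.2⟩⟩
  invFun y := ⟨(Fin.cons y.2.1 y.1.1 : Fin (L.length + 1) → N),
    fun j => Fin.cases y.2.2.1 (fun j => y.1.2.1 j) j,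
    (indepMod_smul_cons_iff hf he L y.1.1 y.2.2.1).2 ⟨y.1.2.2, y.2.2.2⟩⟩
  left_inv v := Subtype.ext (Fin.cons_self_tail (α := fun _ => N) v.1)
  right_inv _ := rfl

/-- The head of a sorted list is its smallest entry and is chosen last, as `card_extend` requires;
the number of extensions is the same for every tuple on the tail. -/
theorem card_indepTuple [Finite N] {f : R} (hf : (Ideal.span {f}).IsMaximal) (L : List ℕ)
    (hL : L.Pairwise (· ≤ ·)) (hpos : ∀ i ∈ L, 0 < i) :
    (Nat.card (IndepTuple N f L) : ℚ) =
      listProd (fun i => (Nat.card (Submodule.torsionBy R N (f ^ i)) : ℚ))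
        (Nat.card (R ⧸ Ideal.span {f})) L := by
  induction L with
  | nil =>
    have : Nat.card (IndepTuple N f []) = 1 := by
      rw [Nat.card_eq_one_iff_unique]
      refine ⟨⟨fun a b => Subtype.ext (funext fun j => j.elim0)⟩,
        ⟨⟨fun j => j.elim0, fun j => j.elim0, fun _ _ j => j.elim0⟩⟩⟩
    rw [this]
    simp [listProd]
  | cons e L ih =>
    rw [List.pairwise_cons] at hL
    have he : 0 < e := hpos e (by simp)
    have E := indepTupleConsEquiv (N := N) hf he L
    have : Fintype (IndepTuple N f L) := by
      have : Finite (IndepTuple N f L) := Subtype.finite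
      exact Fintype.ofFinite _
    rw [Nat.card_congr E, Nat.card_sigma, Nat.cast_sum, Finset.sum_congr rfl fun w _ =>
      card_extend he (fun j => hL.1 _ (List.get_mem L j)) w.2.1 w.2.2]
    rw [Finset.sum_const, Finset.card_univ, ← Nat.card_eq_fintype_card, nsmul_eq_mul,
      ih hL.2 fun i hi => hpos i (by simp [hi]), listProd, mul_comm]

end IndepMod

/-! ### Standard modules and their automorphisms -/

section Std

open scoped Classical

variable {F : Type*} [Field F]

theorem MonicIrred.isMaximal (f : MonicIrred F) : (Ideal.span {f.1}).IsMaximal :=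
  PrincipalIdealRing.isMaximal_of_irreducible f.2.2

theorem MonicIrred.ne_zero (f : MonicIrred F) : f.1 ≠ 0 := f.2.2.ne_zero

theorem MonicIrred.isCoprime {f g : MonicIrred F} (h : f ≠ g) : IsCoprime f.1 g.1 := by
  refine f.2.2.coprime_iff_not_dvd.2 fun hd => h (Subtype.ext ?_)
  exact Polynomial.eq_of_monic_of_associated f.2.1 g.2.1 (f.2.2.associated_of_dvd g.2.2 hd)

theorem MonicIrred.natDegree_pos (f : MonicIrred F) : 0 < f.1.natDegree :=
  f.2.2.natDegree_pos

theorem finite_quotient_span [Finite F] {g : F[X]} (hg : g.Monic) :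
    Finite (F[X] ⧸ Ideal.span {g}) := by
  have := hg.finite_quotient
  exact Module.finite_of_finite F

theorem card_quotient_span {g : F[X]} (hg : g.Monic) :
    Nat.card (F[X] ⧸ Ideal.span {g}) = Nat.card F ^ g.natDegree := by
  have := hg.finite_quotient
  rw [Module.natCard_eq_pow_finrank (K := F), finrank_quotient_span_eq_natDegree]

theorem card_quotient_span_pow {g : F[X]} (hg : g.Monic) (e : ℕ) :
    Nat.card (F[X] ⧸ Ideal.span {g ^ e}) = (Nat.card F ^ g.natDegree) ^ e := by
  rw [card_quotient_span (hg.pow e), hg.natDegree_pow, mul_comm, pow_mul]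

theorem smul_quotient_mk {R : Type*} [CommRing R] (I : Ideal R) (r a : R) :
    r • (Ideal.Quotient.mk I a : R ⧸ I) = Ideal.Quotient.mk I (r * a) := rfl

theorem card_torsionBy_quotient_span_pow {f : F[X]} (hf : f.Monic) (e i : ℕ) :
    Nat.card (Submodule.torsionBy F[X] (F[X] ⧸ Ideal.span {f ^ e}) (f ^ i)) =
      (Nat.card F ^ f.natDegree) ^ min i e := by
  rcases le_total e i with h | h
  · have : Submodule.torsionBy F[X] (F[X] ⧸ Ideal.span {f ^ e}) (f ^ i) = ⊤ := by
      rw [eq_top_iff]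
      rintro x -
      obtain ⟨a, rfl⟩ := Ideal.Quotient.mk_surjective x
      rw [Submodule.mem_torsionBy_iff, smul_quotient_mk,
        Ideal.Quotient.eq_zero_iff_mem, Ideal.mem_span_singleton]
      exact (pow_dvd_pow f h).mul_right a
    rw [this, Nat.card_congr Submodule.topEquiv.toEquiv, card_quotient_span_pow hf, min_eq_right h]
  -- The f^i-torsion is the image of multiplication by f^(e-i), whose kernel on F[t] is (f^i).
  · let φ : F[X] →ₗ[F[X]] F[X] ⧸ Ideal.span {f ^ e} :=
      (Submodule.mkQ (Ideal.span {f ^ e})).comp (LinearMap.lsmul F[X] F[X] (f ^ (e - i)))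
    have hφ : ∀ a, φ a = Ideal.Quotient.mk _ (f ^ (e - i) * a) := fun a => rfl
    have he : f ^ e = f ^ (e - i) * f ^ i := by rw [← pow_add, Nat.sub_add_cancel h]
    have hker : LinearMap.ker φ = Ideal.span {f ^ i} := by
      ext a
      rw [LinearMap.mem_ker, hφ, Ideal.Quotient.eq_zero_iff_mem, Ideal.mem_span_singleton,
        Ideal.mem_span_singleton, he, mul_dvd_mul_iff_left (pow_ne_zero _ hf.ne_zero)]
    have hrange : LinearMap.range φ =
        Submodule.torsionBy F[X] (F[X] ⧸ Ideal.span {f ^ e}) (f ^ i) := by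
      ext x
      obtain ⟨a, rfl⟩ := Ideal.Quotient.mk_surjective x
      have hdvd : f ^ e ∣ f ^ i * a ↔ f ^ (e - i) ∣ a := by
        rw [he, mul_comm (f ^ (e - i)), mul_dvd_mul_iff_left (pow_ne_zero _ hf.ne_zero)]
      rw [Submodule.mem_torsionBy_iff, smul_quotient_mk,
        Ideal.Quotient.eq_zero_iff_mem, Ideal.mem_span_singleton, hdvd]
      constructor
      · rintro ⟨b, hb⟩
        rw [hφ, Ideal.Quotient.eq, Ideal.mem_span_singleton] at hb
        have := (pow_dvd_pow f (Nat.sub_le e i)).trans hb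
        rwa [dvd_sub_right (dvd_mul_right _ _)] at this
      · rintro ⟨b, rfl⟩
        exact ⟨b, hφ b⟩
    rw [← hrange, ← Nat.card_congr φ.quotKerEquivRange.toEquiv, hker, card_quotient_span_pow hf,
      min_eq_left h]

theorem smul_quotient_span_eq_zero {f g : F[X]} (h : IsCoprime f g) {x : F[X] ⧸ Ideal.span {g}}
    (hx : f • x = 0) : x = 0 := by
  have hg : g • x = 0 := by
    obtain ⟨a, rfl⟩ := Ideal.Quotient.mk_surjective x
    rw [smul_quotient_mk,
      Ideal.Quotient.eq_zero_iff_mem, Ideal.mem_span_singleton]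
    exact dvd_mul_right _ _
  obtain ⟨a, b, hab⟩ := h
  rw [← one_smul F[X] x, ← hab, add_smul, mul_smul, mul_smul, hx, hg, smul_zero, smul_zero,
    add_zero]

variable {S : Finset (MonicIrred F)}

/-- The direct sum of the cyclic modules `F[t] / (f ^ e)`, for `f` in `S` and `e` in `L f`. -/
abbrev StdModule (S : Finset (MonicIrred F)) (L : S → List ℕ) : Type _ :=
  (x : Σ f : S, Fin (L f).length) → F[X] ⧸ Ideal.span {x.1.1.1 ^ (L x.1).get x.2}

instance (L : S → List ℕ) [Finite F] : Finite (StdModule S L) := by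
  have : ∀ x : (Σ f : S, Fin (L f).length),
      Finite (F[X] ⧸ Ideal.span {x.1.1.1 ^ (L x.1).get x.2}) :=
    fun x => finite_quotient_span (x.1.1.2.1.pow _)
  infer_instance

theorem finrank_stdModule (L : S → List ℕ) :
    Module.finrank F (StdModule S L) = ∑ f : S, (L f).sum * f.1.1.natDegree := by
  have : ∀ x : (Σ f : S, Fin (L f).length),
      Module.Finite F (F[X] ⧸ Ideal.span {x.1.1.1 ^ (L x.1).get x.2}) :=
    fun x => (x.1.1.2.1.pow _).finite_quotient
  rw [Module.finrank_pi_fintype]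
  simp only [finrank_quotient_span_eq_natDegree, Fintype.sum_sigma, Polynomial.natDegree_pow]
  refine Finset.sum_congr rfl fun f _ => ?_
  rw [← Finset.sum_mul]
  congr 1
  rw [← List.sum_ofFn]
  congr 1
  apply List.ext_get <;> simp

theorem card_torsionBy_stdModule (L : S → List ℕ) (f : S) (i : ℕ) :
    Nat.card (Submodule.torsionBy F[X] (StdModule S L) (f.1.1 ^ i)) =
      (Nat.card F ^ f.1.1.natDegree) ^ ∑ j, min i ((L f).get j) := by
  let E : Submodule.torsionBy F[X] (StdModule S L) (f.1.1 ^ i) ≃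
      ((x : Σ f : S, Fin (L f).length) → Submodule.torsionBy F[X]
        (F[X] ⧸ Ideal.span {x.1.1.1 ^ (L x.1).get x.2}) (f.1.1 ^ i)) :=
    { toFun := fun v x => ⟨v.1 x, congrFun v.2 x⟩
      invFun := fun v => ⟨fun x => (v x).1, funext fun x => (v x).2⟩
      left_inv := fun v => rfl
      right_inv := fun v => rfl }
  rw [Nat.card_congr E, Nat.card_pi, Fintype.prod_sigma, Finset.prod_eq_single f]
  · simp only [card_torsionBy_quotient_span_pow f.1.2.1, Finset.prod_pow_eq_pow_sum]
  · intro g _ hg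
    refine Finset.prod_eq_one fun j _ => ?_
    rw [Nat.card_eq_one_iff_unique]
    refine ⟨⟨fun a b => Subtype.ext ?_⟩, inferInstance⟩
    have hc : IsCoprime (f.1.1 ^ i) (g.1.1 ^ (L g).get j) :=
      (MonicIrred.isCoprime fun h => hg (Subtype.ext h.symm)).pow
    rw [smul_quotient_span_eq_zero hc a.2, smul_quotient_span_eq_zero hc b.2]
  · simp

/-- The standard generators of `StdModule S L`. -/
def stdGen (L : S → List ℕ) (x : Σ f : S, Fin (L f).length) : StdModule S L :=
  Pi.single x 1

theorem smul_stdGen (L : S → List ℕ) (x : Σ f : S, Fin (L f).length) (a : F[X]) :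
    a • stdGen L x = Pi.single x (Ideal.Quotient.mk _ a) := by
  rw [stdGen, ← Pi.single_smul, ← map_one (Ideal.Quotient.mk _), smul_quotient_mk, mul_one]

theorem pow_smul_stdGen (L : S → List ℕ) (x : Σ f : S, Fin (L f).length) :
    x.1.1.1 ^ (L x.1).get x.2 • stdGen L x = 0 := by
  rw [smul_stdGen, Ideal.Quotient.eq_zero_iff_mem.2 (Ideal.mem_span_singleton_self _),
    Pi.single_zero]

theorem exists_smul_eq_zero_of_prod_smul {R M : Type*} [CommRing R] [AddCommGroup M] [Module R M]
    (K : Submodule R M) (s : Multiset R) {x : M} (hx : x ∈ K) (h0 : x ≠ 0) (hs : s.prod • x = 0) :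
    ∃ f ∈ s, ∃ y ∈ K, y ≠ 0 ∧ f • y = 0 := by
  induction s using Multiset.induction_on with
  | empty => simp [h0] at hs
  | cons a s ih =>
    by_cases h : s.prod • x = 0
    · obtain ⟨f, hf, hy⟩ := ih h
      exact ⟨f, Multiset.mem_cons_of_mem hf, hy⟩
    · exact ⟨a, Multiset.mem_cons_self a s, s.prod • x, K.smul_mem _ hx, h, by
        rwa [smul_smul, ← Multiset.prod_cons]⟩

/-- A product of elements of S annihilates the module; applying its factors to x one at a time, the
last nonzero result is killed by the next factor. -/
theorem exists_smul_eq_zero_of_mem (L : S → List ℕ) (K : Submodule F[X] (StdModule S L))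
    {x : StdModule S L} (hx : x ∈ K) (h0 : x ≠ 0) :
    ∃ f : S, ∃ y ∈ K, y ≠ 0 ∧ f.1.1 • y = 0 := by
  classical
  let s : Multiset F[X] := ∑ x : (Σ f : S, Fin (L f).length),
    Multiset.replicate ((L x.1).get x.2) x.1.1.1
  have hs : s.prod • x = 0 := by
    funext z
    obtain ⟨a, ha⟩ := Ideal.Quotient.mk_surjective (x z)
    rw [Pi.smul_apply, ← ha, smul_quotient_mk]
    refine Ideal.Quotient.eq_zero_iff_mem.2 (Ideal.mem_span_singleton.2 (Dvd.dvd.mul_right ?_ _))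
    rw [Multiset.prod_sum, ← Multiset.prod_replicate]
    exact Finset.dvd_prod_of_mem _ (Finset.mem_univ z)
  obtain ⟨f, hf, hy⟩ := exists_smul_eq_zero_of_prod_smul K s hx h0 hs
  rw [Multiset.mem_sum] at hf
  obtain ⟨z, -, hz⟩ := hf
  rw [Multiset.eq_of_mem_replicate hz] at hy
  exact ⟨z.1, hy⟩

theorem sum_smul_stdGen_apply (L : S → List ℕ) (f : S) (a : Fin (L f).length → F[X])
    (j : Fin (L f).length) :
    (∑ k, a k • stdGen L ⟨f, k⟩) ⟨f, j⟩ = Ideal.Quotient.mk _ (a j) := by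
  simp only [smul_stdGen, Finset.sum_apply]
  rw [Finset.sum_eq_single j, Pi.single_eq_same]
  · intro k _ hk
    exact Pi.single_eq_of_ne (fun h => hk (by simpa using h.symm)) _
  · simp

theorem dvd_of_sum_smul_stdGen_eq_zero {L : S → List ℕ} {f : S} {a : Fin (L f).length → F[X]}
    (h : ∑ k, a k • stdGen L ⟨f, k⟩ = 0) (j : Fin (L f).length) :
    f.1.1 ^ (L f).get j ∣ a j := by
  rw [← Ideal.mem_span_singleton, ← Ideal.Quotient.eq_zero_iff_mem]
  exact (sum_smul_stdGen_apply L f a j).symm.trans (congrFun h ⟨f, j⟩)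

theorem eq_sum_smul_stdGen_of_pow_smul_eq_zero {L : S → List ℕ} {f : S} {y : StdModule S L} {n : ℕ}
    (hy : f.1.1 ^ n • y = 0) :
    ∃ c : Fin (L f).length → F[X], y = ∑ j, c j • stdGen L ⟨f, j⟩ := by
  choose c hc using fun j => Ideal.Quotient.mk_surjective (y ⟨f, j⟩)
  refine ⟨c, funext fun ⟨g, k⟩ => ?_⟩
  by_cases hg : g = f
  · subst hg
    rw [sum_smul_stdGen_apply, hc]
  · simp only [smul_stdGen, Finset.sum_apply]
    rw [Finset.sum_eq_zero]
    · refine smul_quotient_span_eq_zero ?_ (congrFun hy ⟨g, k⟩)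
      exact (MonicIrred.isCoprime fun h => hg (Subtype.ext h.symm)).pow
    · intro j _
      exact Pi.single_eq_of_ne (fun h : (⟨g, k⟩ : Σ f : S, Fin (L f).length) = ⟨f, j⟩ =>
        hg (congrArg Sigma.fst h)) _

theorem eq_sum_smul_stdGen_of_smul_eq_zero {L : S → List ℕ} (hL : ∀ f, ∀ i ∈ L f, 0 < i) {f : S}
    {y : StdModule S L} (hy : f.1.1 • y = 0) :
    ∃ c : Fin (L f).length → F[X],
      y = ∑ j, c j • f.1.1 ^ ((L f).get j - 1) • stdGen L ⟨f, j⟩ := by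
  obtain ⟨a, rfl⟩ := eq_sum_smul_stdGen_of_pow_smul_eq_zero (n := 1) (by rwa [pow_one])
  have h : ∀ j, f.1.1 ^ ((L f).get j - 1) ∣ a j := fun j => by
    simp only [Finset.smul_sum, smul_smul] at hy
    have := dvd_of_sum_smul_stdGen_eq_zero hy j
    rwa [← Nat.sub_add_cancel (hL f _ (List.get_mem (L f) j)), pow_succ',
      mul_dvd_mul_iff_left f.1.ne_zero] at this
  choose c hc using h
  exact ⟨c, Finset.sum_congr rfl fun j _ => by rw [smul_smul, mul_comm, ← hc]⟩

variable {N : Type*} [AddCommGroup N] [Module F[X] N]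

/-- A nonzero kernel contains a nonzero element killed by some f in S. Such elements are
combinations of the f^(e_j - 1) times the generators, and independence of the images makes the
combination vanish. -/
theorem injective_iff_indepMod {L : S → List ℕ} (hL : ∀ f, ∀ i ∈ L f, 0 < i)
    (T : StdModule S L →ₗ[F[X]] N) :
    Function.Injective T ↔ ∀ f : S,
      IndepMod f.1.1 fun j => f.1.1 ^ ((L f).get j - 1) • T (stdGen L ⟨f, j⟩) := by
  constructor
  · intro hT f a ha j
    have h1 : T (∑ j, a j • f.1.1 ^ ((L f).get j - 1) • stdGen L ⟨f, j⟩) = 0 := by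
      simpa using ha
    have h2 := hT (h1.trans T.map_zero.symm)
    simp only [smul_smul] at h2
    have h3 := dvd_of_sum_smul_stdGen_eq_zero h2 j
    conv_lhs at h3 => rw [← Nat.sub_add_cancel (hL f _ (List.get_mem (L f) j)), pow_succ']
    rwa [mul_dvd_mul_iff_right (pow_ne_zero _ f.1.ne_zero)] at h3
  · intro h
    rw [← LinearMap.ker_eq_bot, Submodule.eq_bot_iff]
    intro x hx
    by_contra h0
    obtain ⟨f, y, hyK, hy0, hy⟩ := exists_smul_eq_zero_of_mem L _ hx h0
    obtain ⟨c, rfl⟩ := eq_sum_smul_stdGen_of_smul_eq_zero hL hy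
    refine hy0 (Finset.sum_eq_zero fun j _ => ?_)
    obtain ⟨d, hd⟩ := h f c (by simpa using hyK) j
    rw [hd, mul_comm, mul_smul, smul_smul f.1.1, ← pow_succ',
      Nat.sub_add_cancel (hL f _ (List.get_mem _ _)), pow_smul_stdGen L ⟨f, j⟩, smul_zero]

/-- The linear map from `StdModule S L` with prescribed values on the generators. -/
def stdLift {L : S → List ℕ} (v : (Σ f : S, Fin (L f).length) → N)
    (hv : ∀ x, x.1.1.1 ^ (L x.1).get x.2 • v x = 0) : StdModule S L →ₗ[F[X]] N :=
  LinearMap.lsum F[X] _ F[X] fun x =>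
    Submodule.liftQSpanSingleton _ (LinearMap.toSpanSingleton F[X] N (v x)) (hv x)

theorem stdLift_stdGen {L : S → List ℕ} (v : (Σ f : S, Fin (L f).length) → N)
    (hv : ∀ x, x.1.1.1 ^ (L x.1).get x.2 • v x = 0) (x) : stdLift v hv (stdGen L x) = v x := by
  rw [stdLift, stdGen, LinearMap.lsum_piSingle]
  exact one_smul _ _

theorem stdModule_hom_ext {L : S → List ℕ} {T U : StdModule S L →ₗ[F[X]] N}
    (h : ∀ x, T (stdGen L x) = U (stdGen L x)) : T = U := by
  refine LinearMap.pi_ext fun x a => ?_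
  obtain ⟨a, rfl⟩ := Ideal.Quotient.mk_surjective a
  rw [← smul_stdGen, map_smul, map_smul, h]

/-- Injective maps out of `StdModule S L` are families of independent tuples. -/
def injectiveEquiv {L : S → List ℕ} (hL : ∀ f, ∀ i ∈ L f, 0 < i) :
    {T : StdModule S L →ₗ[F[X]] N // Function.Injective T} ≃
      ((f : S) → IndepTuple N f.1.1 (L f)) where
  toFun T f := ⟨fun j => T.1 (stdGen L ⟨f, j⟩), fun j => by
    rw [← map_smul, pow_smul_stdGen L ⟨f, j⟩, map_zero], (injective_iff_indepMod hL T.1).1 T.2 f⟩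
  invFun v := ⟨stdLift (fun x => (v x.1).1 x.2) fun x => (v x.1).2.1 x.2, by
    rw [injective_iff_indepMod hL]
    intro f
    simp only [stdLift_stdGen]
    exact (v f).2.2⟩
  left_inv T := Subtype.ext (stdModule_hom_ext fun x => stdLift_stdGen _ _ x)
  right_inv v := funext fun f => Subtype.ext (funext fun j =>
    stdLift_stdGen (fun x => (v x.1).1 x.2) (fun x => (v x.1).2.1 x.2) ⟨f, j⟩)

/-- Automorphisms of a finite module are its injective endomorphisms. -/
def autEquivInjective {R M : Type*} [CommRing R] [AddCommGroup M] [Module R M] [Finite M] :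
    (M ≃ₗ[R] M) ≃ {T : M →ₗ[R] M // Function.Injective T} where
  toFun e := ⟨e, e.injective⟩
  invFun T := LinearEquiv.ofBijective T.1 (Finite.injective_iff_bijective.1 T.2)
  left_inv _ := LinearEquiv.ext fun _ => rfl
  right_inv _ := Subtype.ext (LinearMap.ext fun _ => rfl)

/-- The standard module with prescribed partitions as types of its primary parts. -/
abbrev TypeModule (φ : S → AnyPartition) : Type _ := StdModule S fun f => (φ f).sorted

theorem card_torsionBy_typeModule (φ : S → AnyPartition) (f : S) (i : ℕ) :
    Nat.card (Submodule.torsionBy F[X] (TypeModule φ) (f.1.1 ^ i)) =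
      (Nat.card F ^ f.1.1.natDegree) ^ (φ f).firstCols i := by
  rw [card_torsionBy_stdModule, AnyPartition.sum_get_sorted, AnyPartition.firstCols_eq_sum_min]

theorem finrank_typeModule (φ : S → AnyPartition) :
    Module.finrank F (TypeModule φ) = ∑ f : S, (φ f).size * f.1.1.natDegree := by
  rw [finrank_stdModule]
  refine Finset.sum_congr rfl fun f _ => ?_
  rw [← Multiset.sum_coe, AnyPartition.coe_sorted, AnyPartition.parts_sum]

theorem card_aut_typeModule [Finite F] (φ : S → AnyPartition) :
    (Nat.card (TypeModule φ ≃ₗ[F[X]] TypeModule φ) : ℚ) =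
      ∏ f : S, (φ f).c ((Nat.card F : ℚ) ^ f.1.1.natDegree) := by
  have hpos : ∀ f, ∀ i ∈ (φ f).sorted, 0 < i := fun f i hi => AnyPartition.pos_of_mem_sorted hi
  rw [Nat.card_congr (autEquivInjective.trans (injectiveEquiv hpos)), Nat.card_pi, Nat.cast_prod]
  refine Finset.prod_congr rfl fun f _ => ?_
  rw [card_indepTuple f.1.isMaximal _ (φ f).pairwise_sorted (hpos f), c_eq_listProd,
    card_quotient_span f.1.2.1]
  simp only [card_torsionBy_typeModule]
  push_cast
  rfl

end Std

/-! ### Size of a similarity class -/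

section Conjugacy

theorem card_linearEquiv_of_finrank_eq {F M : Type*} [Field F] [AddCommGroup M] [Module F M] {n : ℕ}
    [Module.Finite F M] (h : Module.finrank F M = n) :
    Nat.card ((Fin n → F) ≃ₗ[F] M) = Nat.card (Matrix.GeneralLinearGroup (Fin n) F) := by
  have e₀ : M ≃ₗ[F] (Fin n → F) := LinearEquiv.ofFinrankEq _ _ (by simpa using h)
  refine Nat.card_congr (Equiv.trans ?_ (Matrix.GeneralLinearGroup.toLin.trans
    (LinearMap.GeneralLinearGroup.generalLinearEquiv F (Fin n → F))).symm.toEquiv)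
  exact
    { toFun := fun e => e.trans e₀
      invFun := fun e => e.trans e₀.symm
      left_inv := fun e => LinearEquiv.ext fun _ => by simp
      right_inv := fun e => LinearEquiv.ext fun _ => by simp }

variable {F : Type*} [Field F] {n : ℕ} {M : Type*} [AddCommGroup M] [Module F M] [Module F[X] M]
  [IsScalarTower F F[X] M]

/-- The matrix by which `t` acts on `M`, in the coordinates given by `e`. -/
def actionMatrix (e : (Fin n → F) ≃ₗ[F] M) : Matrix (Fin n) (Fin n) F :=
  LinearMap.toMatrixRight' (e.symm.toLinearMap ∘ₗ
    (LinearMap.lsmul F[X] M Polynomial.X).restrictScalars F ∘ₗ e.toLinearMap)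

theorem actionMatrix_eq_iff (e : (Fin n → F) ≃ₗ[F] M) (X : Matrix (Fin n) (Fin n) F) :
    actionMatrix e = X ↔ ∀ v, e (Matrix.vecMulLinear X v) = (Polynomial.X : F[X]) • e v := by
  rw [actionMatrix, ← LinearEquiv.eq_symm_apply, LinearMap.ext_iff]
  refine forall_congr' fun v => ?_
  change e.symm ((Polynomial.X : F[X]) • e v) = Matrix.vecMul v X ↔ _
  rw [LinearEquiv.symm_apply_eq, eq_comm]
  rfl

/-- Coordinates on `M` with action matrix `X` are isomorphisms from the row module of `X`. -/
def actionMatrixFiberEquiv (X : Matrix (Fin n) (Fin n) F) :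
    {e : (Fin n → F) ≃ₗ[F] M // actionMatrix e = X} ≃ (RowModule X ≃ₗ[F[X]] M) where
  toFun e := LinearEquiv.ofAEval _ e.1 ((actionMatrix_eq_iff e.1 X).1 e.2)
  invFun g := ⟨(Module.AEval'.of _).trans (g.restrictScalars F),
    (actionMatrix_eq_iff _ X).2 fun v => by
      change g (Module.AEval'.of _ _) = _ • g (Module.AEval'.of _ v)
      rw [← map_smul, Module.AEval'.X_smul_of]
      rfl⟩
  left_inv e := Subtype.ext (LinearEquiv.ext fun _ => rfl)
  right_inv g := LinearEquiv.ext fun _ => rfl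

/-- Double count of the F-linear isomorphisms from F^n to M: each yields the matrix of t, and the
isomorphisms yielding a given X are the module isomorphisms from its row module, a torsor under Aut
M. -/
theorem card_rowModule_equiv_mul_card_aut [Finite F] [Finite M]
    (h : Module.finrank F M = n) :
    Nat.card {X : Matrix (Fin n) (Fin n) F // Nonempty (RowModule X ≃ₗ[F[X]] M)} *
      Nat.card (M ≃ₗ[F[X]] M) = Nat.card (Matrix.GeneralLinearGroup (Fin n) F) := by
  have : Module.Finite F M := Module.Finite.of_finite
  have : Finite ((Fin n → F) ≃ₗ[F] M) := DFunLike.finite _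
  let P (X : Matrix (Fin n) (Fin n) F) : Prop := Nonempty (RowModule X ≃ₗ[F[X]] M)
  let E₁ : (Σ X : Subtype P, {e : (Fin n → F) ≃ₗ[F] M // actionMatrix e = X.1}) ≃
      ((Fin n → F) ≃ₗ[F] M) :=
    Equiv.sigmaSubtypeFiberEquiv actionMatrix P
      fun e => ⟨actionMatrixFiberEquiv (actionMatrix e) ⟨e, rfl⟩⟩
  have E₂ (X : Subtype P) :
      (M ≃ₗ[F[X]] M) ≃ {e : (Fin n → F) ≃ₗ[F] M // actionMatrix e = X.1} :=
    let g₀ : RowModule X.1 ≃ₗ[F[X]] M := X.2.some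
    Equiv.trans
      { toFun := fun g => g₀.trans g
        invFun := fun g => g₀.symm.trans g
        left_inv := fun g => LinearEquiv.ext fun _ => by simp
        right_inv := fun g => LinearEquiv.ext fun _ => by simp }
      (actionMatrixFiberEquiv X.1).symm
  rw [← card_linearEquiv_of_finrank_eq (F := F) (M := M) h, ← Nat.card_prod]
  exact Nat.card_congr (((Equiv.sigmaEquivProd _ _).symm.trans
    (Equiv.sigmaCongrRight E₂)).trans E₁)

end Conjugacy

/-! ### Classification of row modules by partitions -/

section Classification

open scoped Classical

variable {F : Type*} [Field F]

theorem exists_equiv_get {α : Type*} [Fintype α] (g : α → ℕ) (L : List ℕ)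
    (h : Finset.univ.val.map g = (L : Multiset ℕ)) :
    ∃ τ : Fin L.length ≃ α, ∀ j, g (τ j) = L.get j := by
  have hL : Finset.univ.val.map L.get = (L : Multiset ℕ) := by
    rw [Fin.univ_val_map, List.ofFn_get]
  have e : ∀ c, Nonempty ({j // L.get j = c} ≃ {a // g a = c}) := fun c => by
    rw [← Fintype.card_eq, Fintype.card_subtype, Fintype.card_subtype]
    have := congrArg (Multiset.count c) (hL.trans h.symm)
    simpa only [Finset.card_def, Finset.filter_val, Multiset.count_map, eq_comm (a := c)] using this
  exact ⟨Equiv.ofFiberEquiv fun c => (e c).some, fun j => Equiv.ofFiberEquiv_map _ j⟩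

theorem eq_top_of_stdGen_mem {S : Finset (MonicIrred F)} {L : S → List ℕ}
    {K : Submodule F[X] (StdModule S L)} (h : ∀ x, stdGen L x ∈ K) : K = ⊤ := by
  rw [← K.ker_mkQ, LinearMap.ker_eq_top]
  refine stdModule_hom_ext fun x => ?_
  simpa using h x

/-- Zero exponents are allowed, since the structure theorem may produce trivial summands; these are
discarded and the rest sorted by irreducible and exponent. -/
theorem exists_typeModule_equiv_pi {S : Finset (MonicIrred F)} {ι : Type*} [Fintype ι]
    (p : ι → MonicIrred F) (e : ι → ℕ) (hS : ∀ i, 0 < e i → p i ∈ S) :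
    ∃ φ : S → AnyPartition,
      Nonempty ((∀ i, F[X] ⧸ Ideal.span {(p i).1 ^ e i}) ≃ₗ[F[X]] TypeModule φ) := by
  let φ : S → AnyPartition := fun f => AnyPartition.ofParts
    ((Finset.univ : Finset {i // p i = f.1 ∧ 0 < e i}).val.map fun i => e i.1)
  have hφ : ∀ f : S, (Finset.univ : Finset {i // p i = f.1 ∧ 0 < e i}).val.map (fun i => e i.1) =
      ((φ f).sorted : Multiset ℕ) := fun f => by
    rw [AnyPartition.coe_sorted, AnyPartition.parts_ofParts]
    intro i hi
    obtain ⟨a, -, rfl⟩ := Multiset.mem_map.1 hi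
    exact a.2.2
  choose τ hτ using fun f => exists_equiv_get _ _ (hφ f)
  refine ⟨φ, ?_⟩
  let σ : (Σ f : S, Fin (φ f).sorted.length) → ι := fun x => τ x.1 x.2
  have hσp : ∀ x, p (σ x) = x.1 := fun x => (τ x.1 x.2).2.1
  have hσe : ∀ x, e (σ x) = (φ x.1).sorted.get x.2 := fun x => hτ x.1 x.2
  have hσ : Function.Injective σ := by
    rintro ⟨f, j⟩ ⟨g, k⟩ h
    have hfg : f = g := Subtype.ext ((hσp ⟨f, j⟩).symm.trans ((congrArg p h).trans (hσp ⟨g, k⟩)))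
    subst hfg
    exact congrArg (Sigma.mk f) ((τ f).injective (Subtype.ext h))
  have hσs : ∀ i, 0 < e i → ∃ x, σ x = i := fun i hi =>
    ⟨⟨⟨p i, hS i hi⟩, (τ ⟨p i, hS i hi⟩).symm ⟨i, rfl, hi⟩⟩, by simp [σ]⟩
  let G : (∀ i, F[X] ⧸ Ideal.span {(p i).1 ^ e i}) →ₗ[F[X]] TypeModule φ :=
    LinearMap.pi fun x => (Submodule.quotEquivOfEq (Ideal.span {(p (σ x)).1 ^ e (σ x)})
      (Ideal.span {x.1.1.1 ^ ((φ x.1).sorted).get x.2}) (by rw [hσp, hσe])).toLinearMap ∘ₗ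
        LinearMap.proj (σ x)
  have hG : ∀ v x, G v x = Submodule.quotEquivOfEq (Ideal.span {(p (σ x)).1 ^ e (σ x)})
      (Ideal.span {x.1.1.1 ^ ((φ x.1).sorted).get x.2}) (by rw [hσp, hσe]) (v (σ x)) :=
    fun v x => rfl
  refine ⟨LinearEquiv.ofBijective G ⟨?_, ?_⟩⟩
  · rw [← LinearMap.ker_eq_bot, Submodule.eq_bot_iff]
    intro v hv
    funext i
    rcases (e i).eq_zero_or_pos with h | h
    · obtain ⟨a, ha⟩ := Ideal.Quotient.mk_surjective (v i)
      rw [← ha, Pi.zero_apply, Ideal.Quotient.eq_zero_iff_mem, h, pow_zero,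
        Ideal.span_singleton_one]
      trivial
    · obtain ⟨x, rfl⟩ := hσs i h
      have := congrFun hv x
      rw [hG] at this
      exact (LinearEquiv.map_eq_zero_iff _).1 this
  · rw [← LinearMap.range_eq_top]
    refine eq_top_of_stdGen_mem fun x => ⟨Pi.single (σ x) 1, ?_⟩
    funext y
    rw [hG, stdGen]
    by_cases h : y = x
    · subst h
      rw [Pi.single_eq_same, Pi.single_eq_same]
      rfl
    · rw [Pi.single_eq_of_ne h, Pi.single_eq_of_ne (hσ.ne h), map_zero]

theorem isTorsion_rowModule {n : ℕ} (X : Matrix (Fin n) (Fin n) F) :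
    Module.IsTorsion F[X] (RowModule X) := by
  intro x
  refine ⟨⟨minpoly F (Matrix.vecMulLinear X : Module.End F (Fin n → F)),
    mem_nonZeroDivisors_of_ne_zero (minpoly.ne_zero (Algebra.IsIntegral.isIntegral _))⟩, ?_⟩
  apply (Module.AEval'.of _).symm.injective
  change (Module.AEval'.of (Matrix.vecMulLinear X)).symm (minpoly F _ • x) = _
  rw [Module.AEval.of_symm_smul, minpoly.aeval, zero_smul, map_zero]

theorem finrank_rowModule {n : ℕ} (X : Matrix (Fin n) (Fin n) F) :
    Module.finrank F (RowModule X) = n := by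
  rw [← (Module.AEval'.of (Matrix.vecMulLinear X)).finrank_eq]
  simp

theorem exists_rowModule_equiv_typeModule {n : ℕ} {S : Finset (MonicIrred F)}
    (hS : ∀ f : MonicIrred F, f.1.natDegree ≤ n → f ∈ S) (X : Matrix (Fin n) (Fin n) F) :
    ∃ φ : S → AnyPartition, Nonempty (RowModule X ≃ₗ[F[X]] TypeModule φ) := by
  obtain ⟨ι, _, p, hp, e, ⟨E⟩⟩ := Module.equiv_directSum_of_isTorsion (isTorsion_rowModule X)
  let p' : ι → MonicIrred F := fun i => ⟨normalize (p i), Polynomial.monic_normalize (hp i).ne_zero,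
    (normalize_associated _).symm.irreducible (hp i)⟩
  have hp' : ∀ i, Ideal.span {p i ^ e i} = Ideal.span {(p' i).1 ^ e i} := fun i =>
    Ideal.span_singleton_eq_span_singleton.2 ((normalize_associated _).symm.pow_pow)
  let E' : RowModule X ≃ₗ[F[X]] ∀ i, F[X] ⧸ Ideal.span {(p' i).1 ^ e i} :=
    (E.trans (DirectSum.linearEquivFunOnFintype _ _ _)).trans
      (LinearEquiv.piCongrRight fun i => Submodule.quotEquivOfEq _ _ (hp' i))
  have hfin : ∀ i, Module.Finite F (F[X] ⧸ Ideal.span {(p' i).1 ^ e i}) := fun i =>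
    ((p' i).2.1.pow _).finite_quotient
  -- Comparing dimensions bounds by n the degree of every irreducible with positive exponent, so it
  -- lies in S.
  have hdim : ∑ i, e i * (p' i).1.natDegree = n := by
    rw [← finrank_rowModule X, (E'.restrictScalars F).finrank_eq, Module.finrank_pi_fintype]
    simp only [finrank_quotient_span_eq_natDegree, Polynomial.natDegree_pow]
  obtain ⟨φ, ⟨G⟩⟩ := exists_typeModule_equiv_pi p' e (S := S) fun i hi => by
    apply hS
    rw [← hdim]
    exact (Nat.le_mul_of_pos_left _ hi).trans
      (Finset.single_le_sum (f := fun i => e i * (p' i).1.natDegree) (fun _ _ => Nat.zero_le _)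
        (Finset.mem_univ i))
  exact ⟨φ, ⟨E'.trans G⟩⟩

theorem card_torsionBy_congr {R M N : Type*} [CommRing R] [AddCommGroup M] [Module R M]
    [AddCommGroup N] [Module R N] (e : M ≃ₗ[R] N) (a : R) :
    Nat.card (Submodule.torsionBy R M a) = Nat.card (Submodule.torsionBy R N a) :=
  Nat.card_congr (e.toEquiv.subtypeEquiv fun x => by
    change a • x = 0 ↔ a • e x = 0
    rw [← map_smul, LinearEquiv.map_eq_zero_iff])

theorem one_lt_card_pow_natDegree [Finite F] (f : MonicIrred F) :
    1 < Nat.card F ^ f.1.natDegree :=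
  Nat.one_lt_pow f.natDegree_pos.ne' Finite.one_lt_card

theorem typeModule_injective [Finite F] {S : Finset (MonicIrred F)} {φ ψ : S → AnyPartition}
    (e : TypeModule φ ≃ₗ[F[X]] TypeModule ψ) : φ = ψ := by
  funext f
  refine AnyPartition.ext_firstCols fun i => ?_
  have := card_torsionBy_congr e (f.1.1 ^ i)
  rw [card_torsionBy_typeModule, card_torsionBy_typeModule] at this
  exact Nat.pow_right_injective (one_lt_card_pow_natDegree f.1) this

end Classification

/-! ### Cyclic primary parts and divisors of the characteristic polynomial -/

section Cyclic

variable {F : Type*} [Field F] {n : ℕ}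

theorem vecMul_aeval_of_vecMul_eq_smul {K : Type*} [Field K] [Algebra F K]
    {X : Matrix (Fin n) (Fin n) K} {w : Fin n → K} {α : K}
    (h : Matrix.vecMul w X = α • w) (p : F[X]) :
    Matrix.vecMul w (Polynomial.aeval X p) = Polynomial.aeval α p • w := by
  induction p using Polynomial.induction_on' with
  | add p q hp hq => rw [map_add, map_add, Matrix.vecMul_add, hp, hq, add_smul]
  | monomial k a =>
    have : ∀ k, Matrix.vecMul w (X ^ k) = α ^ k • w := fun k => by
      induction k with
      | zero => simp
      | succ k ih => rw [pow_succ, ← Matrix.vecMul_vecMul, ih, Matrix.smul_vecMul, h, smul_smul,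
          ← pow_succ]
    rw [Polynomial.aeval_monomial, Polynomial.aeval_monomial, ← Algebra.smul_def,
      Matrix.vecMul_smul, this, ← Algebra.smul_def, smul_assoc]

theorem smul_of_rowModule (X : Matrix (Fin n) (Fin n) F) (p : F[X]) (v : Fin n → F) :
    p • Module.AEval'.of (Matrix.vecMulLinear X) v =
      Module.AEval'.of _ (Matrix.vecMul v (Polynomial.aeval X p)) := by
  induction p using Polynomial.induction_on' with
  | add p q hp hq => rw [add_smul, hp, hq, map_add, Matrix.vecMul_add, map_add]
  | monomial k a =>
    have : ∀ k, (Polynomial.X : F[X]) ^ k • Module.AEval'.of (Matrix.vecMulLinear X) v =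
        Module.AEval'.of _ (Matrix.vecMul v (X ^ k)) := fun k => by
      induction k with
      | zero => simp
      | succ k ih =>
        rw [pow_succ', mul_smul, ih, Module.AEval'.X_smul_of, pow_succ, ← Matrix.vecMul_vecMul]
        rfl
    rw [← Polynomial.C_mul_X_pow_eq_monomial, mul_smul, this, Module.AEval.C_smul, map_mul,
      Polynomial.aeval_C, map_pow, Polynomial.aeval_X, ← Algebra.smul_def, Matrix.vecMul_smul,
      map_smul]

theorem charpoly_smul_rowModule (X : Matrix (Fin n) (Fin n) F) (x : RowModule X) :
    X.charpoly • x = 0 := by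
  obtain ⟨v, rfl⟩ := (Module.AEval'.of (Matrix.vecMulLinear X)).surjective x
  rw [smul_of_rowModule, Matrix.aeval_self_charpoly, Matrix.vecMul_zero, map_zero]

/-- Forward: over F[t]/(g) the root of g is an eigenvalue of X, so g(X) is singular there; its
determinant lies in F, so g(X) is singular over F. Backward: Cayley–Hamilton and Bézout. -/
theorem dvd_charpoly_iff (X : Matrix (Fin n) (Fin n) F) {g : F[X]} (hg : Irreducible g) :
    g ∣ X.charpoly ↔ ∃ x : RowModule X, x ≠ 0 ∧ g • x = 0 := by
  constructor
  · intro hd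
    have := Fact.mk hg
    let K := AdjoinRoot g
    let f : F →+* K := algebraMap F K
    have hroot : (X.map f).charpoly.eval (AdjoinRoot.root g) = 0 := by
      rw [Matrix.charpoly_map, Polynomial.eval_map]
      obtain ⟨h, hh⟩ := hd
      rw [hh, Polynomial.eval₂_mul]
      have : Polynomial.eval₂ f (AdjoinRoot.root g) g = 0 := AdjoinRoot.eval₂_root g
      rw [this, zero_mul]
    rw [Matrix.eval_charpoly] at hroot
    obtain ⟨w, hw0, hw⟩ := Matrix.exists_vecMul_eq_zero_iff.2 hroot
    have hw' : Matrix.vecMul w (X.map f) = AdjoinRoot.root g • w := by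
      rw [Matrix.vecMul_sub, sub_eq_zero] at hw
      rw [← hw]
      simp [Matrix.scalar_apply, ← Matrix.smul_one_eq_diagonal, Matrix.vecMul_smul]
    have h1 := vecMul_aeval_of_vecMul_eq_smul (F := F) hw' g
    rw [AdjoinRoot.aeval_eq, AdjoinRoot.mk_self, zero_smul] at h1
    have h2 : Polynomial.aeval (X.map f) g = (Polynomial.aeval X g).map f :=
      Polynomial.aeval_algHom_apply (AlgHom.mapMatrix (Algebra.ofId F K)) X g
    have h3 := Matrix.exists_vecMul_eq_zero_iff.1 ⟨w, hw0, h1⟩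
    rw [h2] at h3
    have h4 : (Polynomial.aeval X g).det = 0 := by
      apply f.injective
      rw [RingHom.map_det, map_zero]
      exact h3
    obtain ⟨v, hv0, hv⟩ := Matrix.exists_vecMul_eq_zero_iff.2 h4
    refine ⟨Module.AEval'.of _ v, by simpa using hv0, ?_⟩
    rw [smul_of_rowModule, hv, map_zero]
  · rintro ⟨x, hx0, hx⟩
    by_contra hd
    obtain ⟨a, b, hab⟩ := hg.coprime_iff_not_dvd.2 hd
    apply hx0
    rw [← one_smul F[X] x, ← hab, add_smul, mul_smul, mul_smul, hx, charpoly_smul_rowModule,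
      smul_zero, smul_zero, add_zero]

theorem mem_primaryPart {X : Matrix (Fin n) (Fin n) F} {g : F[X]} {x : RowModule X} :
    x ∈ primaryPart X g ↔ ∃ k, g ^ k • x = 0 := by
  rw [primaryPart, Ideal.primaryComponent_mem]
  refine exists_congr fun k => ?_
  rw [Ideal.span_singleton_pow, Submodule.torsionBySet_span_singleton_eq,
    Submodule.mem_torsionBy_iff]

/-- On the finite cyclic module generated by v, multiplication by f has kernel and cokernel of equal
size, and the cokernel is a quotient of R/(f). -/
theorem card_torsionBy_span_singleton_le {R M : Type*} [CommRing R] [AddCommGroup M] [Module R M]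
    [Finite M] (f : R) [Finite (R ⧸ Ideal.span {f})] (v : M)
    (h : Submodule.torsionBy R M f ≤ Submodule.span R {v}) :
    Nat.card (Submodule.torsionBy R M f) ≤ Nat.card (R ⧸ Ideal.span {f}) := by
  let V := Submodule.span R {v}
  let μ : V →ₗ[R] V := LinearMap.lsmul R V f
  let v' : V := ⟨v, Submodule.mem_span_singleton_self v⟩
  have hker : Nat.card (LinearMap.ker μ) = Nat.card (Submodule.torsionBy R M f) :=
    Nat.card_congr
      { toFun := fun x => ⟨x.1.1, congrArg Subtype.val (LinearMap.mem_ker.1 x.2)⟩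
        invFun := fun x => ⟨⟨x.1, h x.2⟩, Subtype.ext x.2⟩
        left_inv := fun _ => rfl
        right_inv := fun _ => rfl }
  have h1 := card_eq_card_ker_mul_card_range μ
  have h2 := Submodule.card_eq_card_quotient_mul_card (LinearMap.range μ)
  have h3 : Nat.card (LinearMap.ker μ) = Nat.card (V ⧸ LinearMap.range μ) := by
    rw [h1, mul_comm] at h2
    exact Nat.eq_of_mul_eq_mul_left Nat.card_pos h2
  rw [← hker, h3]
  let π : R ⧸ Ideal.span {f} →ₗ[R] V ⧸ LinearMap.range μ :=
    Submodule.liftQSpanSingleton f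
      ((LinearMap.range μ).mkQ ∘ₗ LinearMap.toSpanSingleton R V v') (by
        change (LinearMap.range μ).mkQ (f • v') = 0
        rw [Submodule.mkQ_apply, Submodule.Quotient.mk_eq_zero]
        exact ⟨v', rfl⟩)
  refine Nat.card_le_card_of_surjective π fun y => ?_
  obtain ⟨⟨y, hy⟩, rfl⟩ := (LinearMap.range μ).mkQ_surjective y
  obtain ⟨a, rfl⟩ := Submodule.mem_span_singleton.1 hy
  exact ⟨Ideal.Quotient.mk _ a, rfl⟩

variable [Finite F] {S : Finset (MonicIrred F)}

/-- With Q = q^deg f, the f-torsion has Q^λ'_1 elements, and a cyclic primary part allows at most Q.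
Conversely, at most one standard generator belongs to f, and it generates the primary part (0 does
if there is none). -/
theorem isCyclicAt_iff {X : Matrix (Fin n) (Fin n) F} {φ : S → AnyPartition}
    (E : RowModule X ≃ₗ[F[X]] TypeModule φ) (f : S) :
    IsCyclicAt X f.1.1 ↔ (φ f).conj 1 ≤ 1 := by
  constructor
  · rintro ⟨v, hv⟩
    have : Finite (RowModule X) := Finite.of_equiv _ E.toEquiv.symm
    have := finite_quotient_span f.1.2.1
    have h1 := card_torsionBy_span_singleton_le f.1.1 v (by
      rw [← hv]
      exact fun x hx => mem_primaryPart.2 ⟨1, by rw [pow_one]; exact hx⟩)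
    have h2 := card_torsionBy_typeModule φ f 1
    rw [pow_one, AnyPartition.firstCols_one] at h2
    rw [card_torsionBy_congr E, h2, card_quotient_span f.1.2.1] at h1
    exact (Nat.pow_le_pow_iff_right (one_lt_card_pow_natDegree f.1)).1 (by rwa [pow_one])
  · intro h
    rw [← AnyPartition.length_sorted] at h
    have : Subsingleton (Fin (φ f).sorted.length) := Fin.subsingleton_iff_le_one.2 h
    have key : ∃ v : TypeModule φ, (∃ k, f.1.1 ^ k • v = 0) ∧
        ∀ y : TypeModule φ, (∃ k, f.1.1 ^ k • y = 0) → ∃ a : F[X], a • v = y := by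
      rcases isEmpty_or_nonempty (Fin (φ f).sorted.length) with hE | ⟨⟨j⟩⟩
      · refine ⟨0, ⟨0, by simp⟩, fun y ⟨k, hy⟩ => ⟨0, ?_⟩⟩
        obtain ⟨c, rfl⟩ := eq_sum_smul_stdGen_of_pow_smul_eq_zero hy
        simp
      · refine ⟨stdGen _ ⟨f, j⟩,
          ⟨(φ f).sorted.get j, pow_smul_stdGen (fun f => (φ f).sorted) ⟨f, j⟩⟩, fun y ⟨k, hy⟩ => ?_⟩
        obtain ⟨c, rfl⟩ := eq_sum_smul_stdGen_of_pow_smul_eq_zero hy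
        refine ⟨c j, ?_⟩
        rw [Finset.sum_eq_single j (fun i _ hi => (hi (Subsingleton.elim i j)).elim) (by simp)]
    obtain ⟨v, ⟨k, hk⟩, hv⟩ := key
    refine ⟨E.symm v, ?_⟩
    ext x
    rw [mem_primaryPart, Submodule.mem_span_singleton]
    constructor
    · rintro ⟨m, hm⟩
      obtain ⟨a, ha⟩ := hv (E x) ⟨m, by rw [← map_smul, hm, map_zero]⟩
      exact ⟨a, by rw [← map_smul, ha, E.symm_apply_apply]⟩
    · rintro ⟨a, rfl⟩
      exact ⟨k, by rw [smul_comm, ← map_smul, hk, map_zero, smul_zero]⟩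

theorem dvd_charpoly_iff_conj {X : Matrix (Fin n) (Fin n) F} {φ : S → AnyPartition}
    (E : RowModule X ≃ₗ[F[X]] TypeModule φ) (f : S) :
    f.1.1 ∣ X.charpoly ↔ (φ f).conj 1 ≠ 0 := by
  have h2 := card_torsionBy_typeModule φ f 1
  rw [pow_one, AnyPartition.firstCols_one, ← card_torsionBy_congr E] at h2
  rw [dvd_charpoly_iff X f.1.2.2, ← not_iff_not, not_not]
  have hQ := one_lt_card_pow_natDegree f.1
  have h3 : (φ f).conj 1 = 0 ↔ Nat.card (Submodule.torsionBy F[X] (RowModule X) f.1.1) = 1 := by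
    rw [h2, Nat.pow_eq_one, or_iff_right hQ.ne']
  rw [h3, Nat.card_eq_one_iff_unique]
  constructor
  · intro h
    push Not at h
    refine ⟨⟨fun a b => Subtype.ext ?_⟩, inferInstance⟩
    have hz : ∀ a : Submodule.torsionBy F[X] (RowModule X) f.1.1, a.1 = 0 := fun a => by
      by_contra h0
      exact h a.1 h0 a.2
    rw [hz a, hz b]
  · rintro ⟨hs, -⟩ ⟨x, hx0, hx⟩
    exact hx0 (congrArg Subtype.val (hs.elim ⟨x, hx⟩ 0))

theorem isUncyclic_iff (hS : ∀ f : MonicIrred F, f.1.natDegree ≤ n → f ∈ S)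
    {X : Matrix (Fin n) (Fin n) F} {φ : S → AnyPartition}
    (E : RowModule X ≃ₗ[F[X]] TypeModule φ) : IsUncyclic X ↔ ∀ f, φ f ∈ Lambda1 := by
  have hiff : ∀ f : S, (f.1.1 ∣ X.charpoly → ¬ IsCyclicAt X f.1.1) ↔ φ f ∈ Lambda1 := fun f => by
    rw [dvd_charpoly_iff_conj E, isCyclicAt_iff E]
    change _ ↔ (φ f).conj 1 ≠ 1
    omega
  constructor
  · exact fun h f => (hiff f).1 (h f.1.1 f.1.2.1 f.1.2.2)
  · intro h g hm hi hd
    have hdeg : g.natDegree ≤ n := by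
      have := Polynomial.natDegree_le_of_dvd hd X.charpoly_monic.ne_zero
      rwa [Matrix.charpoly_natDegree_eq_dim, Fintype.card_fin] at this
    exact (hiff ⟨⟨g, hm, hi⟩, hS ⟨g, hm, hi⟩ hdeg⟩).2 (h _) hd

end Cyclic

open scoped Classical

/-! ### Finiteness and the count of uncyclic matrices -/

section Finiteness

theorem finite_lambda1_size_le (n : ℕ) : {l : Lambda1 | l.1.size ≤ n}.Finite := by
  have h : {l : AnyPartition | l.size ≤ n}.Finite := by
    refine (Set.finite_range fun x : Σ k : Fin (n + 1), (k : ℕ).Partition =>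
      (⟨x.1, x.2⟩ : AnyPartition)).subset ?_
    rintro ⟨k, l⟩ hl
    exact ⟨⟨⟨k, Nat.lt_succ_of_le hl⟩, l⟩, rfl⟩
  exact h.preimage Subtype.val_injective.injOn

/-- The members of `Λ₁` of size at most `n`. -/
def lambda1SizeLE (n : ℕ) : Finset Lambda1 := (finite_lambda1_size_le n).toFinset

theorem mem_lambda1SizeLE {n : ℕ} {l : Lambda1} : l ∈ lambda1SizeLE n ↔ l.1.size ≤ n := by
  simp [lambda1SizeLE]

variable (F : Type*) [Field F] [Finite F]

theorem finite_monicIrred_natDegree_le (n : ℕ) :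
    {f : MonicIrred F | f.1.natDegree ≤ n}.Finite := by
  refine Set.Finite.of_injOn (f := fun f (i : Fin (n + 1)) => f.1.coeff i) (Set.mapsTo_univ _ _)
    ?_ Set.finite_univ
  intro f hf g hg h
  refine Subtype.ext (Polynomial.ext fun i => ?_)
  by_cases hi : i < n + 1
  · exact congrFun h ⟨i, hi⟩
  · have hf' : f.1.natDegree ≤ n := hf
    have hg' : g.1.natDegree ≤ n := hg
    rw [Polynomial.coeff_eq_zero_of_natDegree_lt (by omega),
      Polynomial.coeff_eq_zero_of_natDegree_lt (by omega)]

end Finiteness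

section Count

theorem unc_zero (F : Type*) [Field F] : unc F 0 = 1 := by
  rw [unc, Nat.card_eq_one_iff_unique]
  refine ⟨inferInstance, ⟨⟨0, fun g _ hi hd => ?_⟩⟩⟩
  rw [Matrix.charpoly, Matrix.det_isEmpty] at hd
  exact (hi.not_isUnit (isUnit_of_dvd_one hd)).elim

theorem uncSeries_eq (F : Type*) [Field F] : uncSeries F = PowerSeries.mk fun n =>
    (unc F n : ℚ) / Nat.card (Matrix.GeneralLinearGroup (Fin n) F) := by
  ext n
  rw [uncSeries, PowerSeries.coeff_mk, PowerSeries.coeff_mk]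
  split_ifs with h
  · subst h
    rw [unc_zero, Nat.card_unique]
    simp
  · rfl

variable {F : Type*} [Field F] [Finite F] {n : ℕ} {S : Finset (MonicIrred F)}

/-- Each uncyclic matrix has exactly one type; the dimension n of its row module is the weight
condition defining W. -/
theorem unc_eq_sum (hS : ∀ f : MonicIrred F, f.1.natDegree ≤ n → f ∈ S) (W : Finset (S → Lambda1))
    (hW : ∀ φ, φ ∈ W ↔ ∑ f : S, (φ f).1.size * f.1.1.natDegree = n) :
    unc F n = ∑ φ ∈ W, Nat.card {X : Matrix (Fin n) (Fin n) F //
      Nonempty (RowModule X ≃ₗ[F[X]] TypeModule fun f => (φ f).1)} := by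
  rw [← Finset.sum_coe_sort, ← Nat.card_sigma, unc]
  refine (Nat.card_congr (Equiv.ofBijective (fun y => ⟨y.2.1,
    (isUncyclic_iff hS y.2.2.some).2 fun f => (y.1.1 f).2⟩) ⟨?_, ?_⟩)).symm
  · rintro ⟨⟨φ, hφ⟩, ⟨X, ⟨E⟩⟩⟩ ⟨⟨ψ, hψ⟩, ⟨Y, ⟨E'⟩⟩⟩ h
    obtain rfl : X = Y := congrArg Subtype.val h
    have h' := typeModule_injective (E.symm.trans E')
    obtain rfl : φ = ψ := funext fun f => Subtype.ext (congrFun h' f)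
    rfl
  · rintro ⟨X, hX⟩
    obtain ⟨φ, ⟨E⟩⟩ := exists_rowModule_equiv_typeModule hS X
    have hφ := (isUncyclic_iff hS E).1 hX
    refine ⟨⟨⟨fun f => ⟨φ f, hφ f⟩, (hW _).2 ?_⟩, ⟨X, ⟨E⟩⟩⟩, rfl⟩
    rw [← finrank_typeModule, ← (E.restrictScalars F).finrank_eq, finrank_rowModule]

theorem unc_div_card_eq_sum (hS : ∀ f : MonicIrred F, f.1.natDegree ≤ n → f ∈ S)
    (W : Finset (S → Lambda1))
    (hW : ∀ φ, φ ∈ W ↔ ∑ f : S, (φ f).1.size * f.1.1.natDegree = n) :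
    (unc F n : ℚ) / Nat.card (Matrix.GeneralLinearGroup (Fin n) F) =
      ∑ φ ∈ W, ∏ f : S, 1 / (φ f).1.c ((Nat.card F : ℚ) ^ f.1.1.natDegree) := by
  rw [unc_eq_sum hS W hW, Nat.cast_sum, Finset.sum_div]
  refine Finset.sum_congr rfl fun φ hφ => ?_
  have hdim : Module.finrank F (TypeModule fun f => (φ f).1) = n := by
    rw [finrank_typeModule, (hW φ).1 hφ]
  have hcard := card_rowModule_equiv_mul_card_aut (F := F) hdim
  have hpos : 0 < Nat.card (Matrix.GeneralLinearGroup (Fin n) F) := Nat.card_pos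
  rw [← hcard] at hpos
  rw [← hcard, Finset.prod_div_distrib, Finset.prod_const_one, ← card_aut_typeModule, Nat.cast_mul,
    div_mul_cancel_left₀, one_div]
  exact_mod_cast (Nat.pos_of_mul_pos_right hpos).ne'

end Count

/-! ### Coefficients of the product and formal convergence -/

section Series

theorem prod_monomial {R ι : Type*} [CommSemiring R] (s : Finset ι) (d : ι → ℕ) (a : ι → R) :
    ∏ i ∈ s, PowerSeries.monomial (d i) (a i) =
      PowerSeries.monomial (∑ i ∈ s, d i) (∏ i ∈ s, a i) := by
  induction s using Finset.induction_on with
  | empty => simp [PowerSeries.monomial_zero_eq_C]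
  | insert i s hi ih =>
    rw [Finset.prod_insert hi, Finset.prod_insert hi, Finset.sum_insert hi, ih,
      PowerSeries.monomial_mul_monomial]

theorem coeff_prod_congr {R ι : Type*} [CommSemiring R] {s : Finset ι} {A B : ι → R⟦X⟧} {n : ℕ}
    (h : ∀ i ∈ s, ∀ k ≤ n, PowerSeries.coeff k (A i) = PowerSeries.coeff k (B i)) :
    PowerSeries.coeff n (∏ i ∈ s, A i) = PowerSeries.coeff n (∏ i ∈ s, B i) := by
  rw [PowerSeries.coeff_prod, PowerSeries.coeff_prod]
  refine Finset.sum_congr rfl fun l hl => Finset.prod_congr rfl fun i hi => h i hi _ ?_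
  rw [← (Finset.mem_finsuppAntidiag.1 hl).1]
  exact Finset.single_le_sum (fun _ _ => Nat.zero_le _) hi

variable {F : Type*} [Field F]

theorem coeff_factorTerm_of_lt {f : MonicIrred F} {l : AnyPartition} {k : ℕ} (h : k < l.size) :
    PowerSeries.coeff k (factorTerm f l) = 0 := by
  rw [factorTerm, PowerSeries.coeff_monomial, if_neg]
  exact (h.trans_le (Nat.le_mul_of_pos_right _ f.natDegree_pos)).ne

/-- The sum of the terms of the factor at `f`, coefficient by coefficient. -/
def factorSum (f : MonicIrred F) : ℚ⟦X⟧ :=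
  PowerSeries.mk fun k => ∑ l ∈ lambda1SizeLE k, PowerSeries.coeff k (factorTerm f l.1)

theorem hasSum_factorTerm [TopologicalSpace ℚ] (f : MonicIrred F) :
    HasSum (fun l : Lambda1 => factorTerm f l) (factorSum f) := by
  rw [PowerSeries.WithPiTopology.hasSum_iff_hasSum_coeff]
  intro k
  rw [factorSum, PowerSeries.coeff_mk]
  refine hasSum_sum_of_ne_finset_zero fun l hl => coeff_factorTerm_of_lt ?_
  rwa [mem_lambda1SizeLE, not_le] at hl

/-- As deg f ≥ 1, partitions of size above k do not reach degree k, so one finite truncation serves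
all degrees up to n. -/
theorem coeff_factorSum_of_le (f : MonicIrred F) {k n : ℕ} (hk : k ≤ n) :
    PowerSeries.coeff k (factorSum f) =
      PowerSeries.coeff k (∑ l ∈ lambda1SizeLE n, factorTerm f l.1) := by
  rw [factorSum, PowerSeries.coeff_mk, map_sum]
  refine Finset.sum_subset (fun l hl => ?_) fun l _ hl => coeff_factorTerm_of_lt ?_
  · rw [mem_lambda1SizeLE] at hl ⊢
    exact hl.trans hk
  · rwa [mem_lambda1SizeLE, not_le] at hl

theorem coeff_prod_factorSum [Finite F] {n : ℕ} {S : Finset (MonicIrred F)}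
    (hS : ∀ f : MonicIrred F, f.1.natDegree ≤ n → f ∈ S) :
    PowerSeries.coeff n (∏ f ∈ S, factorSum f) =
      (unc F n : ℚ) / Nat.card (Matrix.GeneralLinearGroup (Fin n) F) := by
  rw [coeff_prod_congr fun f _ k hk => coeff_factorSum_of_le f hk, ← Finset.prod_coe_sort,
    Finset.prod_univ_sum, map_sum]
  rw [unc_div_card_eq_sum hS ((Fintype.piFinset fun _ => lambda1SizeLE n).filter
    fun φ => n = ∑ f : S, (φ f).1.size * f.1.1.natDegree), Finset.sum_filter]
  · refine Finset.sum_congr rfl fun φ _ => ?_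
    simp only [factorTerm]
    rw [prod_monomial, PowerSeries.coeff_monomial]
  · intro φ
    rw [Finset.mem_filter, Fintype.mem_piFinset, eq_comm (a := n), and_iff_right_iff_imp]
    intro h f
    rw [mem_lambda1SizeLE, ← h]
    exact (Nat.le_mul_of_pos_right _ f.1.natDegree_pos).trans
      (Finset.single_le_sum (f := fun f : S => (φ f).1.size * f.1.1.natDegree)
        (fun _ _ => Nat.zero_le _) (Finset.mem_univ f))

/-- The n-th coefficient of a finite partial product is constant once all f of degree at most n are
included. -/
theorem hasProd_factorSum [Finite F] [TopologicalSpace ℚ] :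
    HasProd (fun f : MonicIrred F => factorSum f) (uncSeries F) := by
  rw [HasProd, SummationFilter.unconditional_filter,
    PowerSeries.WithPiTopology.tendsto_iff_coeff_tendsto]
  intro n
  refine Filter.Tendsto.congr' ?_ tendsto_const_nhds
  filter_upwards [Filter.eventually_ge_atTop (finite_monicIrred_natDegree_le F n).toFinset]
    with S hS
  rw [coeff_prod_factorSum fun f hf => hS (by simpa using hf), uncSeries_eq, PowerSeries.coeff_mk]

end Series

end Uncyclic

end

theorem propositionP (F : Type*) [Field F] [Finite F]
    -- formal convergence (coefficientwise stabilisation): `ℚ` carries the discrete topology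
    [TopologicalSpace ℚ] [DiscreteTopology ℚ] :
    (∀ l : Uncyclic.AnyPartition,
      l ∈ Uncyclic.Lambda1 ↔ (l.parts.card = 0 ∨ 2 ≤ l.parts.card)) ∧
    Uncyclic.uncSeries F = PowerSeries.mk (fun n =>
      (Uncyclic.unc F n : ℚ) / (Nat.card (Matrix.GeneralLinearGroup (Fin n) F) : ℚ)) ∧
    (∀ f : Uncyclic.MonicIrred F,
      Summable (fun l : Uncyclic.Lambda1 => Uncyclic.factorTerm f l)) ∧
    HasProd
      (fun f : Uncyclic.MonicIrred F => ∑' l : Uncyclic.Lambda1, Uncyclic.factorTerm f l)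
      (Uncyclic.uncSeries F) := by
  refine ⟨Uncyclic.mem_Lambda1_iff, Uncyclic.uncSeries_eq F,
    fun f => (Uncyclic.hasSum_factorTerm f).summable, ?_⟩
  -- Uniqueness of limits identifies each `tsum` with the coefficientwise sum.
  have : T2Space ℚ⟦X⟧ := PowerSeries.WithPiTopology.instT2Space ℚ
  simp only [fun f : Uncyclic.MonicIrred F => (Uncyclic.hasSum_factorTerm f).tsum_eq]
  exact Uncyclic.hasProd_factorSum
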